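/- Let $\Psi=(X^*,\Phi,X_*,\Phi^\vee)$ be a root datum ($\Phi$ finite, not necessarily reduced), with Weyl group $W$, generated by the reflections $w_\beta$ ($\beta\in\Phi$). Let $\Gamma$ be a finite group acting on $\Psi$ by automorphisms, and suppose that there is a $\Gamma$-stable set $\Delta$ of simple roots in $\Phi$. Let $V^*=X^*\otimes\mathbb{Q}$, let $i^*\colon V^*\to V^*_\Gamma$ be the quotient map to the space of $\Gamma$-coinvariants, and put $\bar X^*=i^*(X^*)$, $\bar\Phi=i^*(\Phi)$ and $\bar X_*=X_*^\Gamma$, paired by $\langle i^*x,\lambda\rangle=\langle x,\lambda\rangle$ for $x\in X^*$, $\lambda\in\bar X_*$. For $\beta\in\Phi$ let $\Xi_\beta=\Gamma\cdot\beta$ if this orbit is an orthogonal set; otherwise let $\Xi_\beta$ be the set of roots $\theta+\theta'$, where $\theta\neq\theta'$ run over the pairs of non-orthogonal elements of $\Gamma\cdot\beta$. For $\alpha\in\bar\Phi$ put $$\alpha^\vee=\frac{|\Gamma\cdot\beta|}{|\Xi_\beta|}\sum_{\xi\in\Xi_\beta}\xi^\vee\in\bar X_*,$$ where $\beta\in\Phi$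 is any root with $i^*\beta=\alpha$, and let $\bar\Phi^\vee=\{\alpha^\vee\mid\alpha\in\bar\Phi\}$. Then $\bar\Psi=(\bar X^*,\bar\Phi,\bar X_*,\bar\Phi^\vee)$ is a root datum (with $\alpha^\vee$ independent of the choice of $\beta$). Let $\bar W$ be the Weyl group of $\bar\Psi$, and let $W^\Gamma$ be the group of $\Gamma$-fixed elements of $W$ (where $\gamma\in\Gamma$ acts by $w\mapsto\gamma w\gamma^{-1}$), which acts on $\bar X^*$ by $w(i^*x)=i^*(w(x))$ for $x\in X^*$. For every $\bar w\in\bar W$ there is a unique $w\in W^\Gamma$ whose action on $\bar X^*$ coincides with that of $\bar w$, and the resulting homomorphism $\bar W\to W^\Gamma$, $\bar w\mapsto w$, is an isomorphism of groups. -/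

import Mathlib

open scoped TensorProduct

noncomputable section

namespace RestrictedRootDatum

variable {ι X Y Γ : Type*} [AddCommGroup X] [AddCommGroup Y] [Group Γ]

/-- A set of simple roots (a base) of the root system of a root datum, given by indices of roots:
the roots in it are linearly independent, and every root is a linear combination of them with
integer coefficients that are all nonnegative or all nonpositive. Unlike `RootPairing.Base` there
is no condition on coroots, so that this is the usual notion also if the root system is not
reduced. -/
structure IsSimpleRootSet (P : RootDatum ι X Y) (Δ : Set ι) : Prop where
  linearIndepOn : LinearIndepOn ℤ P.root Δ
  mem_or_neg_mem (i : ι) : P.root i ∈ AddSubmonoid.closure (P.root '' Δ) ∨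
    -P.root i ∈ AddSubmonoid.closure (P.root '' Δ)

variable (P : RootDatum ι X Y) (φ : Γ →* P.Aut)

/-- The representation of `Γ` on `V^* = ℚ ⊗ X^*`. -/
def rationalRep : Representation ℚ Γ (ℚ ⊗[ℤ] X) where
  toFun γ := ((φ γ).weightMap).baseChange ℚ
  map_one' := by
    rw [map_one]
    exact LinearMap.baseChange_id
  map_mul' γ δ := by
    rw [map_mul]
    exact LinearMap.baseChange_comp _ _

/-- The map `i^*` on `X^*`, with values in the space `V^*_Γ` of coinvariants of `V^*`. -/
def toCoinvariants : X →ₗ[ℤ] (rationalRep P φ).Coinvariants :=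
  (Representation.Coinvariants.mk (rationalRep P φ)).restrictScalars ℤ ∘ₗ
    TensorProduct.mk ℤ ℚ X 1

/-- `\bar X^*`, the image of `X^*` in the coinvariants of `V^*`. -/
abbrev XBar : Submodule ℤ (rationalRep P φ).Coinvariants :=
  LinearMap.range (toCoinvariants P φ)

/-- The surjection `i^* : X^* → \bar X^*`. -/
def res : X →ₗ[ℤ] XBar P φ := (toCoinvariants P φ).rangeRestrict

/-- `\bar X_*`, the `Γ`-invariants of `X_*`. (An element `γ` acts on `X_*` by the inverse of the
contravariant map `coweightMap`.) -/
def YBar : Submodule ℤ Y where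
  carrier := {y | ∀ γ, (φ γ).coweightMap y = y}
  add_mem' ha hb γ := by rw [map_add, ha γ, hb γ]
  zero_mem' γ := map_zero _
  smul_mem' c y hy γ := by rw [map_smul, hy γ]

/-- `\bar Φ`, the image of the set of roots in `\bar X^*`. -/
def PhiBar : Set (XBar P φ) := Set.range fun i ↦ res P φ (P.root i)

/-- The image under `i^*` of the root with index `i`, as an element of `\bar Φ`. -/
def resRoot (i : ι) : PhiBar P φ := ⟨res P φ (P.root i), i, rfl⟩

lemma toLinearMap_weightMap (g : P.Aut) (x : X) (y : Y) :
    P.toLinearMap (g.weightMap x) y = P.toLinearMap x (g.coweightMap y) :=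
  LinearMap.congr_fun (RootPairing.Hom.weight_coweight_transpose_apply P P y g.toHom) x

lemma toLinearMap_eq_zero_of_res {x : X} (hx : res P φ x = 0) {y : Y} (hy : y ∈ YBar P φ) :
    P.toLinearMap x y = 0 := by
  let f : ℚ ⊗[ℤ] X →ₗ[ℚ] ℚ :=
    LinearMap.liftBaseChange ℚ ((Algebra.linearMap ℤ ℚ) ∘ₗ P.toLinearMap.flip y)
  have hf : ∀ γ, f ∘ₗ rationalRep P φ γ = f := by
    intro γ
    ext x
    have := toLinearMap_weightMap P (φ γ) x y
    rw [hy γ] at this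
    simp [f, rationalRep, this]
  have h0 : toCoinvariants P φ x = 0 := congrArg Subtype.val hx
  have h1 : f (1 ⊗ₜ x) = 0 := by
    rw [← Representation.Coinvariants.lift_mk (rationalRep P φ) f hf]
    exact (congrArg (Representation.Coinvariants.lift (rationalRep P φ) f hf) h0).trans
      (map_zero _)
  simpa [f] using h1

/-- The pairing of `\bar X^*` and `\bar X_*`: the one for which `i^*` is the transpose of the
inclusion `i_*`, see `pairingBar_res`. -/
def pairingBar : XBar P φ →ₗ[ℤ] YBar P φ →ₗ[ℤ] ℤ :=
  (Submodule.liftQ (LinearMap.ker (toCoinvariants P φ))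
      ((LinearMap.lcomp ℤ ℤ (YBar P φ).subtype) ∘ₗ P.toLinearMap)
      (fun _ hx ↦ LinearMap.ext fun y ↦
        toLinearMap_eq_zero_of_res P φ (Subtype.ext hx) y.2)) ∘ₗ
    (toCoinvariants P φ).quotKerEquivRange.symm.toLinearMap

lemma pairingBar_res (x : X) (y : YBar P φ) :
    pairingBar P φ (res P φ x) y = P.toLinearMap x y := by
  have : (toCoinvariants P φ).quotKerEquivRange.symm (res P φ x) =
      Submodule.Quotient.mk x := by
    rw [LinearEquiv.symm_apply_eq]
    rfl
  simp only [pairingBar, LinearMap.comp_apply, LinearEquiv.coe_coe, this]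
  rfl

/-- The pairing is also given by averaging over `Γ`, i.e. by `⟨ι (i^* x), i_* y⟩`. -/
lemma card_mul_pairingBar_res [Fintype Γ] (x : X) (y : YBar P φ) :
    (Fintype.card Γ : ℤ) * pairingBar P φ (res P φ x) y =
      P.toLinearMap (∑ γ, (φ γ).weightMap x) y := by
  simp [pairingBar_res, toLinearMap_weightMap, y.2 _]

/-- The (index set of the) `Γ`-orbit of the root with index `i`. -/
def rootOrbit (i : ι) : Set ι := Set.range fun γ ↦ (φ γ).indexEquiv i

open Classical in
/-- The (index set of the) orthogonal `Γ`-orbit of roots `Ξ_β` attached to the root `β` with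
index `i`: it is `Γ · β` if this is an orthogonal set, and otherwise it consists of the roots
`θ + θ'`, where `θ ≠ θ'` are elements of `Γ · β` that are not orthogonal. -/
def Xi (i : ι) : Set ι :=
  if (rootOrbit P φ i).Pairwise P.IsOrthogonal then rootOrbit P φ i
  else {k | ∃ j ∈ rootOrbit P φ i, ∃ j' ∈ rootOrbit P φ i,
    j ≠ j' ∧ ¬ P.IsOrthogonal j j' ∧ P.root k = P.root j + P.root j'}

lemma indexEquiv_mem_rootOrbit {i j : ι} (γ : Γ) (hj : j ∈ rootOrbit P φ i) :
    (φ γ).indexEquiv j ∈ rootOrbit P φ i := by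
  obtain ⟨δ, rfl⟩ := hj
  exact ⟨γ * δ, by simp only [map_mul]; rfl⟩

lemma pairing_indexEquiv (g : P.Aut) (i j : ι) :
    P.pairing (g.indexEquiv i) (g.indexEquiv j) = P.pairing i j := by
  have h := toLinearMap_weightMap P g (P.root i) (P.coroot (g.indexEquiv j))
  rw [RootPairing.Hom.root_weightMap_apply, RootPairing.Hom.coroot_coweightMap_apply,
    Equiv.symm_apply_apply] at h
  exact h

lemma indexEquiv_mem_Xi {i k : ι} (γ : Γ) (hk : k ∈ Xi P φ i) :
    (φ γ).indexEquiv k ∈ Xi P φ i := by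
  unfold Xi at hk ⊢
  split_ifs at hk ⊢ with h
  · exact indexEquiv_mem_rootOrbit P φ γ hk
  · obtain ⟨j, hj, j', hj', hne, hort, hsum⟩ := hk
    refine ⟨_, indexEquiv_mem_rootOrbit P φ γ hj, _, indexEquiv_mem_rootOrbit P φ γ hj',
      fun e ↦ hne ((φ γ).indexEquiv.injective e), ?_, ?_⟩
    · simpa only [RootPairing.IsOrthogonal, pairing_indexEquiv] using hort
    · simp only [← RootPairing.Hom.root_weightMap_apply, hsum, map_add]

lemma symm_indexEquiv_mem_Xi {i k : ι} (γ : Γ) (hk : k ∈ Xi P φ i) :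
    (φ γ).indexEquiv.symm k ∈ Xi P φ i := by
  have h := indexEquiv_mem_Xi P φ γ⁻¹ hk
  rw [map_inv] at h
  exact h

/-- The group `W^Γ` of elements of the Weyl group that are fixed under the action
`w ↦ γ w γ⁻¹` of `Γ`. -/
def fixedWeylGroup : Subgroup P.Aut :=
  P.weylGroup ⊓ Subgroup.centralizer (Set.range φ)

variable [Finite ι]

lemma sum_coroot_Xi_mem (i : ι) :
    ∑ k ∈ (Xi P φ i).toFinite.toFinset, P.coroot k ∈ YBar P φ := by
  intro γ
  rw [map_sum]
  refine Finset.sum_bij' (fun k _ ↦ (φ γ).indexEquiv.symm k) (fun k _ ↦ (φ γ).indexEquiv k)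
    ?_ ?_ ?_ ?_ ?_
  · intro k hk
    rw [Set.Finite.mem_toFinset] at hk ⊢
    exact symm_indexEquiv_mem_Xi P φ γ hk
  · intro k hk
    rw [Set.Finite.mem_toFinset] at hk ⊢
    exact indexEquiv_mem_Xi P φ γ hk
  · intro k _
    exact Equiv.apply_symm_apply _ _
  · intro k _
    exact Equiv.symm_apply_apply _ _
  · intro k _
    exact RootPairing.Hom.coroot_coweightMap_apply P P k _

/-- The coroot `α^∨ = (|Γ · β| / |Ξ_β|) ∑_{ξ ∈ Ξ_β} ξ^∨` in `\bar X_*`, where `β` is the root with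
index `i` and `α = i^* β`. The quotient is an integer (`1` or `2`) if `Γ` stabilizes a set of
simple roots. -/
def corootBar (i : ι) : YBar P φ :=
  ((rootOrbit P φ i).ncard / (Xi P φ i).ncard) •
    ⟨∑ k ∈ (Xi P φ i).toFinite.toFinset, P.coroot k, sum_coroot_Xi_mem P φ i⟩

end RestrictedRootDatum

end

/-! Averaging a coweight that is positive on `Δ` gives a `Γ`-invariant, strictly dominant `y`. No
root vanishes on `y`, and its value on a root depends only on the image under `i^*`; everything
rests on this `y`.

Two distinct roots of one `Γ`-orbit have equal length and equal value on `y`, so their difference is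
not a root: they are orthogonal or pair to `-1` (`pairing_of_mem_rootOrbit`). Positivity of the
invariant form on the orbit sum leaves each root at most one non-orthogonal partner
(`eq_of_not_isOrthogonal`). Hence `Ξ_β` is orthogonal, its elements restrict to `m • i^*β` with `m =
|Γβ| / |Ξ_β|` equal to `1` or `2`, and the product of its reflections lies in `W^Γ` and induces the
reflection in `i^*β` (`exists_mem_fixedWeylGroup`). So these reflections preserve `\bar Φ`. As a
reflection preserving a finite set determines its coroot on the span of that set, the remaining root
datum axioms follow.

The same products lift `\bar W` to `W^Γ`. Lifts are unique: an element of `W^Γ` acting trivially on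
`\bar X^*` preserves values on `y`, hence positivity of roots, and `W` acts freely on chambers
(`IsSimpleRootSet.eq_one_of_pos`). For surjectivity, given `w` in `W^Γ`, some element of `\bar W`
moves the invariant regular coweight `w⁻¹y` back to the dominant chamber; its lift composed with `w`
preserves positive roots, so it is `w⁻¹`. -/

open scoped TensorProduct

noncomputable section

namespace RestrictedRootDatum

/-! ### Automorphisms, reflections and integral functionals -/

section Generalities

variable {ι X Y : Type*} [AddCommGroup X] [AddCommGroup Y] (P : RootDatum ι X Y)

include P in
lemma isAddTorsionFree_weight : IsAddTorsionFree X := by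
  have := Module.IsReflexive.of_isPerfPair P.toLinearMap
  exact .of_isTorsionFree ℤ X

include P in
lemma isAddTorsionFree_coweight : IsAddTorsionFree Y :=
  isAddTorsionFree_weight P.flip

lemma exists_toLinearMap_eq (f : Module.Dual ℤ X) : ∃ y, ∀ x, P.toLinearMap x y = f x :=
  ⟨P.toLinearMap.flip.toPerfPair.symm f, fun x ↦ by simp⟩

lemma aut_ext {g h : P.Aut} (H : ∀ x : X, g • x = h • x) : g = h :=
  RootPairing.Equiv.weightHom_injective P (LinearEquiv.ext H)

lemma aut_smul_root (g : P.Aut) (i : ι) : g • P.root i = P.root (g.indexEquiv i) :=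
  (RootPairing.Equiv.root_indexEquiv_eq_smul P i g).symm

lemma reflection_smul_eq (i : ι) (x : X) :
    RootPairing.Equiv.reflection P i • x = x - P.toLinearMap x (P.coroot i) • P.root i := by
  simp [RootPairing.reflection_apply]

lemma toLinearMap_smul (g : P.Aut) (x : X) (y : Y) :
    P.toLinearMap (g • x) y = P.toLinearMap x (g.coweightMap y) :=
  toLinearMap_weightMap P g x y

lemma coweightMap_coroot (g : P.Aut) (i : ι) :
    g.coweightMap (P.coroot (g.indexEquiv i)) = P.coroot i := by
  rw [RootPairing.Hom.coroot_coweightMap_apply, Equiv.symm_apply_apply]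

/-- The pairing is invariant under automorphisms. -/
lemma toLinearMap_smul_coroot (g : P.Aut) (x : X) (i : ι) :
    P.toLinearMap (g • x) (P.coroot (g.indexEquiv i)) = P.toLinearMap x (P.coroot i) := by
  rw [toLinearMap_smul, coweightMap_coroot]

lemma conj_reflection (g : P.Aut) (i : ι) :
    g * RootPairing.Equiv.reflection P i * g⁻¹ =
      RootPairing.Equiv.reflection P (g.indexEquiv i) := by
  refine aut_ext P fun x ↦ ?_
  obtain ⟨x, rfl⟩ : ∃ x', x = g • x' := ⟨g⁻¹ • x, by rw [smul_inv_smul]⟩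
  rw [mul_smul, mul_smul, inv_smul_smul, reflection_smul_eq, reflection_smul_eq,
    toLinearMap_smul_coroot, smul_sub, smul_comm, aut_smul_root]

lemma reflection_mul_self (i : ι) :
    RootPairing.Equiv.reflection P i * RootPairing.Equiv.reflection P i = 1 := by
  nth_rw 1 [← RootPairing.Equiv.reflection_inv]
  exact inv_mul_cancel _

/-- Coroots scale inversely to roots. This absorbs the non-reduced case, where a simple reflection
may negate several positive roots. -/
lemma reflection_eq_of_root_eq_smul [Finite ι] {i j : ι} {t : ℤ}
    (h : P.root j = t • P.root i) :
    RootPairing.Equiv.reflection P j = RootPairing.Equiv.reflection P i := by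
  have := isAddTorsionFree_coweight P
  have h' := RootPairing.smul_coroot_eq_of_root_eq_smul i j t h
  refine aut_ext P fun x ↦ ?_
  rw [reflection_smul_eq, reflection_smul_eq, ← h', h, map_smul, smul_eq_mul, mul_comm, mul_smul]

variable {P} in
/-- A linear functional with prescribed values, up to a common factor, on a linearly independent
set of roots. -/
lemma exists_toLinearMap_root_eq [Module.Finite ℤ X] {Δ : Set ι}
    (hΔ : LinearIndepOn ℤ P.root Δ) (c : ι → ℤ) :
    ∃ (y : Y) (N : ℤ), 0 < N ∧ ∀ i ∈ Δ, P.toLinearMap (P.root i) y = N * c i := by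
  let m : X →ₗ[ℤ] ℚ ⊗[ℤ] X := TensorProduct.mk ℤ ℚ X 1
  have hli : LinearIndependent ℚ (fun i : Δ ↦ m (P.root i)) :=
    LinearIndependent.of_isLocalizedModule (S := nonZeroDivisors ℤ) (Rₛ := ℚ)
      (f := TensorProduct.mk ℤ ℚ X 1) hΔ
  obtain ⟨F, hF'⟩ := LinearMap.exists_extend
    (Finsupp.linearCombination ℚ (fun i : Δ ↦ (c i : ℚ)) ∘ₗ hli.repr)
  have hF (i : ι) (hi : i ∈ Δ) : F (m (P.root i)) = c i := by
    have h1 := LinearMap.congr_fun hF' ⟨m (P.root i), Submodule.subset_span ⟨⟨i, hi⟩, rfl⟩⟩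
    rw [LinearMap.comp_apply, LinearMap.comp_apply, hli.repr_eq_single ⟨i, hi⟩ _ rfl] at h1
    simpa using h1
  obtain ⟨s, hs⟩ := Module.Finite.fg_top (R := ℤ) (M := X)
  obtain ⟨a, ha⟩ := IsLocalization.exist_integer_multiples_of_finset (nonZeroDivisors ℤ)
    (s.image fun x ↦ F (m x))
  let G : X →ₗ[ℤ] ℚ := (a : ℤ) • (F.restrictScalars ℤ ∘ₗ m)
  have hG : ∀ x, G x ∈ LinearMap.range (Algebra.linearMap ℤ ℚ) := by
    intro x
    have : (⊤ : Submodule ℤ X) ≤ (LinearMap.range (Algebra.linearMap ℤ ℚ)).comap G := by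
      rw [← hs, Submodule.span_le]
      intro x hx
      obtain ⟨n, hn⟩ := ha _ (Finset.mem_image_of_mem _ hx)
      exact ⟨n, hn⟩
    exact this trivial
  let e := LinearEquiv.ofInjective (Algebra.linearMap ℤ ℚ) Int.cast_injective
  let f : Module.Dual ℤ X := e.symm.toLinearMap ∘ₗ G.codRestrict _ hG
  have hf (x : X) : (f x : ℚ) = G x :=
    congrArg Subtype.val (e.apply_symm_apply (G.codRestrict _ hG x))
  have ha0 : (a : ℤ) ≠ 0 := nonZeroDivisors.coe_ne_zero a
  -- One factor `a` clears denominators; the second makes the common factor `a * a` positive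
  -- whatever the sign of `a`.
  obtain ⟨y, hy⟩ := exists_toLinearMap_eq P ((a : ℤ) • f)
  refine ⟨y, a * a, mul_self_pos.mpr ha0, fun i hi ↦ ?_⟩
  rw [hy]
  have : (f (P.root i) : ℚ) = a * c i := by
    rw [hf, ← hF i hi]
    simp [G]
  have : f (P.root i) = a * c i := by exact_mod_cast this
  simp [this, mul_assoc]

end Generalities

/-! ### Positive cone and dominant coweights -/

section SimpleRoots

variable {ι X Y : Type*} [AddCommGroup X] [AddCommGroup Y] {P : RootDatum ι X Y} {Δ : Set ι}

lemma toLinearMap_nonneg_of_mem_closure {y : Y} (hy : ∀ i ∈ Δ, 0 ≤ P.toLinearMap (P.root i) y)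
    {x : X} (hx : x ∈ AddSubmonoid.closure (P.root '' Δ)) : 0 ≤ P.toLinearMap x y := by
  induction hx using AddSubmonoid.closure_induction with
  | mem x hx => obtain ⟨i, hi, rfl⟩ := hx; exact hy i hi
  | zero => simp
  | add x x' _ _ h h' => simpa using add_nonneg h h'

/-- An element of `Y` that is strictly dominant with respect to a set of simple roots. -/
def IsDominant (P : RootDatum ι X Y) (Δ : Set ι) (y : Y) : Prop :=
  ∀ i ∈ Δ, 0 < P.toLinearMap (P.root i) y

lemma IsDominant.eq_zero_or_pos {y : Y} (hy : IsDominant P Δ y) {x : X}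
    (hx : x ∈ AddSubmonoid.closure (P.root '' Δ)) : x = 0 ∨ 0 < P.toLinearMap x y := by
  induction hx using AddSubmonoid.closure_induction with
  | mem x hx => obtain ⟨i, hi, rfl⟩ := hx; exact .inr (hy i hi)
  | zero => exact .inl rfl
  | add x x' _ _ h h' =>
    obtain rfl | h := h
    · simpa using h'
    obtain rfl | h' := h'
    · simpa using Or.inr h
    · right; simpa using add_pos h h'

lemma IsSimpleRootSet.mem_closure (hΔ : IsSimpleRootSet P Δ) {y : Y} (hy : IsDominant P Δ y)
    {i : ι} (hi : 0 ≤ P.toLinearMap (P.root i) y) :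
    P.root i ∈ AddSubmonoid.closure (P.root '' Δ) := by
  refine (hΔ.mem_or_neg_mem i).resolve_right fun h ↦ ?_
  obtain h' | h' := hy.eq_zero_or_pos h
  · exact P.ne_zero i (neg_eq_zero.mp h')
  · rw [map_neg, LinearMap.neg_apply] at h'
    linarith

lemma IsSimpleRootSet.toLinearMap_ne_zero (hΔ : IsSimpleRootSet P Δ) {y : Y}
    (hy : IsDominant P Δ y) (i : ι) : P.toLinearMap (P.root i) y ≠ 0 := by
  intro h
  have h1 := hΔ.mem_closure hy h.ge
  have h2 := hΔ.mem_closure hy (i := P.reflectionPerm i i) (by simp [h])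
  obtain h' | h' := hy.eq_zero_or_pos h1
  · exact P.ne_zero i h'
  · omega

end SimpleRoots

/-! ### The canonical invariant form -/

section RootForm

variable {ι X Y : Type*} [AddCommGroup X] [AddCommGroup Y] (P : RootDatum ι X Y)

/-- Lets signs of pairings with coroots be read off from the form, which is positive on roots. -/
lemma two_mul_rootForm_root [Fintype ι] (x : X) (i : ι) :
    2 * P.RootForm x (P.root i) =
      P.toLinearMap x (P.coroot i) * P.RootForm (P.root i) (P.root i) := by
  have h := congrArg (P.toLinearMap x) (P.rootForm_self_smul_coroot i)
  rw [map_smul, map_nsmul, P.toLinearMap_apply_apply_Polarization] at h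
  rw [← P.rootForm_symmetric.eq, RingHom.id_apply]
  simpa [mul_comm] using h.symm

lemma rootForm_root_pos [Fintype ι] (i : ι) : 0 < P.RootForm (P.root i) (P.root i) :=
  P.rootForm_pos_of_ne_zero (Submodule.subset_span ⟨i, rfl⟩)
    (have := isAddTorsionFree_weight P; P.ne_zero i)

end RootForm

/-! ### Exchange property and free action on chambers -/

section SimpleRoots

variable {ι X Y : Type*} [AddCommGroup X] [AddCommGroup Y] {P : RootDatum ι X Y} {Δ : Set ι}

open RootPairing (Equiv.reflection)

/-- A simple reflection makes only the multiples of the simple root negative. -/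
lemma IsSimpleRootSet.exists_eq_smul [Module.Finite ℤ X] (hΔ : IsSimpleRootSet P Δ) {y : Y}
    (hy : IsDominant P Δ y) {d i : ι} (hd : d ∈ Δ) (hi : 0 < P.toLinearMap (P.root i) y)
    (hi' : P.toLinearMap (Equiv.reflection P d • P.root i) y < 0) :
    ∃ t : ℤ, P.root i = t • P.root d := by
  classical
  -- `z` kills `d` and is positive on the other simple roots. The root and the negative of its
  -- reflection both lie in the positive cone and have opposite values on `z`, so both values
  -- vanish.
  obtain ⟨z, N, hN, hz⟩ := exists_toLinearMap_root_eq hΔ.linearIndepOn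
    (fun j ↦ if j = d then 0 else 1)
  have hz0 : P.toLinearMap (P.root d) z = 0 := by simp [hz d hd]
  have hzpos (j : ι) (hj : j ∈ Δ) : 0 ≤ P.toLinearMap (P.root j) z := by
    rw [hz j hj]; split_ifs <;> simp [hN.le]
  let k := P.reflectionPerm d i
  have hk : P.root (P.reflectionPerm k k) = -(Equiv.reflection P d • P.root i) := by
    rw [P.root_reflectionPerm, P.reflection_apply_self, P.root_reflectionPerm]
    rfl
  have ha := hΔ.mem_closure hy hi.le
  have hb := hΔ.mem_closure hy (i := P.reflectionPerm k k) (by rw [hk]; simp at hi' ⊢; omega)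
  have ha' := toLinearMap_nonneg_of_mem_closure hzpos ha
  have hb' := toLinearMap_nonneg_of_mem_closure hzpos hb
  rw [hk, reflection_smul_eq] at hb'
  simp only [map_neg, map_sub, map_smul, LinearMap.neg_apply, LinearMap.sub_apply,
    LinearMap.smul_apply, hz0] at hb'
  have key (x : X) (hx : x ∈ AddSubmonoid.closure (P.root '' Δ)) :
      (∃ t : ℤ, x = t • P.root d) ∨ 0 < P.toLinearMap x z := by
    induction hx using AddSubmonoid.closure_induction with
    | mem x hx =>
      obtain ⟨j, hj, rfl⟩ := hx
      by_cases hjd : j = d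
      · exact .inl ⟨1, by simp [hjd]⟩
      · right; simpa [hz j hj, hjd] using hN
    | zero => exact .inl ⟨0, by simp⟩
    | add x x' hx hx' h h' =>
      have h1 := toLinearMap_nonneg_of_mem_closure hzpos hx
      have h1' := toLinearMap_nonneg_of_mem_closure hzpos hx'
      rw [map_add, LinearMap.add_apply]
      obtain ⟨t, rfl⟩ | h := h
      · obtain ⟨t', rfl⟩ | h' := h'
        · exact .inl ⟨t + t', by rw [add_smul]⟩
        · right; omega
      · right; omega
  obtain h | h := key _ ha
  · exact h
  · simp at hb'; omega

/-- Simple reflections generate the Weyl group. -/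
lemma IsSimpleRootSet.reflection_mem_closure [Finite ι] [Module.Finite ℤ X]
    (hΔ : IsSimpleRootSet P Δ) {y : Y} (hy : IsDominant P Δ y) (i : ι) :
    Equiv.reflection P i ∈ Subgroup.closure (Equiv.reflection P '' Δ) := by
  have := Fintype.ofFinite ι
  have hsimple (d : ι) (hd : d ∈ Δ) :
      Equiv.reflection P d ∈ Subgroup.closure (Equiv.reflection P '' Δ) :=
    Subgroup.subset_closure ⟨d, hd, rfl⟩
  have key (n : ℕ) : ∀ i, 0 < P.toLinearMap (P.root i) y → P.toLinearMap (P.root i) y ≤ n →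
      Equiv.reflection P i ∈ Subgroup.closure (Equiv.reflection P '' Δ) := by
    induction n with
    | zero => intro i h h'; simp at h'; omega
    | succ n ih =>
      intro i hi hin
      -- Otherwise the root, a nonnegative combination of simple roots, would have nonpositive form
      -- with itself.
      obtain ⟨d, hd, hpos⟩ : ∃ d ∈ Δ, 0 < P.toLinearMap (P.root i) (P.coroot d) := by
        by_contra! hcon
        have (x : X) (hx : x ∈ AddSubmonoid.closure (P.root '' Δ)) :
            P.RootForm (P.root i) x ≤ 0 := by
          induction hx using AddSubmonoid.closure_induction with
          | mem x hx =>
            obtain ⟨d, hd, rfl⟩ := hx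
            have := two_mul_rootForm_root P (P.root i) d
            nlinarith [hcon d hd, rootForm_root_pos P d]
          | zero => simp
          | add x x' _ _ h h' => rw [map_add]; omega
        exact (this _ (hΔ.mem_closure hy hi.le)).not_gt (rootForm_root_pos P i)
      -- Either the reflected root is negative and the root is a multiple of `d`, or it is positive
      -- with a smaller value on `y` and induction applies to the conjugate reflection.
      obtain hlt | hlt := lt_or_gt_of_ne
        (hΔ.toLinearMap_ne_zero hy (P.reflectionPerm d i))
      · rw [RootPairing.root_reflectionPerm, ← RootPairing.Equiv.reflection_smul] at hlt
        obtain ⟨t, ht⟩ := hΔ.exists_eq_smul hy hd hi hlt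
        rw [reflection_eq_of_root_eq_smul P ht]
        exact hsimple d hd
      · have h1 := conj_reflection P (Equiv.reflection P d) (P.reflectionPerm d i)
        rw [RootPairing.Equiv.reflection_indexEquiv, P.reflectionPerm_self] at h1
        rw [← h1]
        refine mul_mem (mul_mem (hsimple d hd) (ih _ hlt ?_)) (inv_mem (hsimple d hd))
        rw [RootPairing.root_reflectionPerm, ← RootPairing.Equiv.reflection_smul,
          reflection_smul_eq]
        simp only [map_sub, map_smul, LinearMap.sub_apply, LinearMap.smul_apply, smul_eq_mul]
        have := mul_pos hpos (hy d hd)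
        push_cast at hin
        omega
  obtain hlt | hlt := lt_or_gt_of_ne (hΔ.toLinearMap_ne_zero hy i)
  · have h1 : P.root (P.reflectionPerm i i) = (-1 : ℤ) • P.root i := by simp
    rw [← reflection_eq_of_root_eq_smul P h1]
    exact key _ _ (by simpa using hlt) (Int.self_le_toNat _)
  · exact key _ _ hlt (Int.self_le_toNat _)

/-- The exchange property. -/
lemma IsSimpleRootSet.exchange [Finite ι] [Module.Finite ℤ X]
    (hΔ : IsSimpleRootSet P Δ) {y : Y} (hy : IsDominant P Δ y) (l : List ι) (hl : ∀ i ∈ l, i ∈ Δ)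
    {d : ι} (hd : d ∈ Δ)
    (h : P.toLinearMap ((l.map (Equiv.reflection P)).prod • P.root d) y < 0) :
    ∃ l' : List ι, (∀ i ∈ l', i ∈ Δ) ∧ l'.length + 1 = l.length ∧
      (l'.map (Equiv.reflection P)).prod =
        (l.map (Equiv.reflection P)).prod * Equiv.reflection P d := by
  induction l with
  | nil =>
    have := hy d hd
    simp at h
    omega
  | cons a l ih =>
    rw [List.forall_mem_cons] at hl
    set w := (l.map (Equiv.reflection P)).prod with hw
    rw [List.map_cons, List.prod_cons, ← hw] at h ⊢
    obtain hlt | hlt := lt_or_gt_of_ne (hΔ.toLinearMap_ne_zero hy (w.indexEquiv d))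
    · rw [← aut_smul_root] at hlt
      obtain ⟨l', h1, h2, h3⟩ := ih hl.2 hlt
      refine ⟨a :: l', by simpa using ⟨hl.1, h1⟩, by simp [h2], ?_⟩
      rw [List.map_cons, List.prod_cons, h3, mul_assoc]
    -- Here the letter `a` turns the positive root `w d` negative, so `w d` is a multiple of `a` and
    -- `s_a = w s_d w⁻¹`: the letter `a` can be deleted.
    · rw [mul_smul, aut_smul_root P w] at h
      obtain ⟨t, ht⟩ := hΔ.exists_eq_smul hy hl.1 hlt h
      refine ⟨l, hl.2, by simp, ?_⟩
      rw [← reflection_eq_of_root_eq_smul P ht, ← conj_reflection, ← hw]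
      simp [mul_assoc, reflection_mul_self, -RootPairing.Equiv.mul_eq_comp]

/-- The Weyl group acts freely on Weyl chambers. -/
lemma IsSimpleRootSet.eq_one_of_pos [Finite ι] [Module.Finite ℤ X]
    (hΔ : IsSimpleRootSet P Δ) {y : Y} (hy : IsDominant P Δ y) {w : P.Aut}
    (hw : w ∈ P.weylGroup)
    (hpos : ∀ i, 0 < P.toLinearMap (P.root i) y → 0 < P.toLinearMap (w • P.root i) y) :
    w = 1 := by
  have hw' : w ∈ Submonoid.closure (Equiv.reflection P '' Δ) := by
    have h1 : w ∈ Subgroup.closure (Equiv.reflection P '' Δ) := by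
      refine (Subgroup.closure_le _).mpr ?_ hw
      rintro _ ⟨i, rfl⟩
      exact hΔ.reflection_mem_closure hy i
    have h2 : (Equiv.reflection P '' Δ)⁻¹ = Equiv.reflection P '' Δ := by
      ext g
      simp [← inv_eq_iff_eq_inv]
    rwa [← Subgroup.mem_toSubmonoid, Subgroup.closure_toSubmonoid, h2, Set.union_self] at h1
  obtain ⟨l, hl, hlw⟩ : ∃ l : List ι, (∀ i ∈ l, i ∈ Δ) ∧
      (l.map (Equiv.reflection P)).prod = w := by
    clear hpos hw
    induction hw' using Submonoid.closure_induction with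
    | mem w h => obtain ⟨i, hi, rfl⟩ := h; exact ⟨[i], by simpa, by simp⟩
    | one => exact ⟨[], by simp, rfl⟩
    | mul w w' _ _ h h' =>
      obtain ⟨l, hl, rfl⟩ := h
      obtain ⟨l', hl', rfl⟩ := h'
      exact ⟨l ++ l', fun i hi ↦ (List.mem_append.mp hi).elim (hl i) (hl' i), by simp⟩
  -- A nonempty word for `w` ending in `d` has a prefix that makes `d` negative, so exchange yields
  -- a word shorter by two.
  induction hn : l.length using Nat.strong_induction_on generalizing l with
  | _ n ih =>
  obtain rfl | ⟨l₀, d, rfl⟩ := l.eq_nil_or_concat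
  · simpa using hlw.symm
  · have hd : d ∈ Δ := hl d (by simp)
    have h1 := hpos d (hy d hd)
    rw [List.concat_eq_append, List.map_append, List.prod_append, List.map_singleton,
      List.prod_singleton] at hlw
    rw [← hlw, mul_smul, RootPairing.Equiv.reflection_smul, P.reflection_apply_self, smul_neg,
      map_neg, LinearMap.neg_apply, neg_pos] at h1
    obtain ⟨l', h2, h3, h4⟩ := hΔ.exchange hy l₀ (fun i hi ↦ hl i (by simp [hi])) hd h1
    exact ih _ (by simp at hn; omega) l' h2 (h4.trans hlw) rfl

end SimpleRoots

/-! ### Orthogonality and products of commuting reflections -/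

section RootForm

variable {ι X Y : Type*} [AddCommGroup X] [AddCommGroup Y] (P : RootDatum ι X Y)

lemma rootForm_smul_smul [Fintype ι] (g : P.Aut) (x x' : X) :
    P.RootForm (g • x) (g • x') = P.RootForm x x' := by
  rw [P.rootForm_apply_apply, P.rootForm_apply_apply]
  refine (Fintype.sum_equiv g.indexEquiv _ _ fun i ↦ ?_).symm
  simp only [LinearMap.flip_apply, toLinearMap_smul_coroot]

lemma isOrthogonal_iff_rootForm_eq_zero [Fintype ι] (i j : ι) :
    P.IsOrthogonal i j ↔ P.RootForm (P.root i) (P.root j) = 0 := by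
  have h1 := two_mul_rootForm_root P (P.root i) j
  have h2 := two_mul_rootForm_root P (P.root j) i
  rw [← P.rootForm_symmetric.eq, RingHom.id_apply] at h2
  have h3 := (rootForm_root_pos P i).ne'
  have h4 := (rootForm_root_pos P j).ne'
  rw [RootPairing.root_coroot_eq_pairing] at h1 h2
  refine ⟨fun h ↦ ?_, fun h ↦ ⟨?_, ?_⟩⟩
  · rw [h.1] at h1; omega
  · simpa [h, h4] using h1
  · simpa [h, h3] using h2

/-- The product of the reflections in a set of pairwise orthogonal roots. -/
lemma exists_mem_weylGroup_of_pairwise_isOrthogonal (s : Finset ι)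
    (hs : (s : Set ι).Pairwise P.IsOrthogonal) :
    ∃ w ∈ P.weylGroup, ∀ x : X,
      w • x = x - ∑ k ∈ s, P.toLinearMap x (P.coroot k) • P.root k := by
  classical
  induction s using Finset.induction_on with
  | empty => exact ⟨1, one_mem _, by simp⟩
  | insert a s ha ih =>
    obtain ⟨w, hw, h⟩ := ih (hs.mono (by simp))
    refine ⟨RootPairing.Equiv.reflection P a * w,
      mul_mem (P.reflection_mem_weylGroup a) hw, fun x ↦ ?_⟩
    have h0 : P.toLinearMap (∑ k ∈ s, P.toLinearMap x (P.coroot k) • P.root k) (P.coroot a) = 0 := by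
      rw [map_sum, LinearMap.sum_apply]
      refine Finset.sum_eq_zero fun k hk ↦ ?_
      have : P.pairing k a = 0 := (hs (by simp [hk]) (by simp) (by rintro rfl; exact ha hk)).1
      simp [this]
    rw [mul_smul, h, reflection_smul_eq, map_sub, LinearMap.sub_apply, h0,
      Finset.sum_insert ha, sub_zero]
    abel

end RootForm

/-! ### Geometry of a `Γ`-orbit of roots -/

section Orbits

variable {ι X Y Γ : Type*} [AddCommGroup X] [AddCommGroup Y] [Group Γ]
  (P : RootDatum ι X Y) (φ : Γ →* P.Aut)

/-- A `Γ`-stable set of simple roots has a `Γ`-invariant strictly dominant coweight. -/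
lemma IsSimpleRootSet.exists_isDominant [Finite Γ] [Module.Finite ℤ X] {Δ : Set ι}
    (hΔ : IsSimpleRootSet P Δ) (hΓ : ∀ γ, ∀ i ∈ Δ, (φ γ).indexEquiv i ∈ Δ) :
    ∃ y ∈ YBar P φ, IsDominant P Δ y := by
  have := Fintype.ofFinite Γ
  obtain ⟨z, N, hN, hz⟩ := exists_toLinearMap_root_eq hΔ.linearIndepOn (fun _ ↦ 1)
  refine ⟨∑ γ, (φ γ).coweightMap z, fun δ ↦ ?_, fun i hi ↦ ?_⟩
  · rw [map_sum]
    refine Fintype.sum_equiv (Equiv.mulRight δ) _ _ fun γ ↦ ?_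
    simp only [Equiv.coe_mulRight, map_mul]
    rfl
  · rw [map_sum]
    refine Finset.sum_pos (fun γ _ ↦ ?_) ⟨1, Finset.mem_univ _⟩
    rw [← toLinearMap_smul, aut_smul_root, hz _ (hΓ γ i hi), mul_one]
    exact hN

lemma self_mem_rootOrbit (i : ι) : i ∈ rootOrbit P φ i :=
  ⟨1, by change (φ 1).indexEquiv i = i; rw [map_one]; rfl⟩

variable {P φ}

lemma exists_indexEquiv_eq {i j k : ι} (hj : j ∈ rootOrbit P φ i) (hk : k ∈ rootOrbit P φ i) :
    ∃ γ, (φ γ).indexEquiv j = k := by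
  obtain ⟨γ, rfl⟩ := hj
  obtain ⟨δ, rfl⟩ := hk
  refine ⟨δ * γ⁻¹, ?_⟩
  have : φ (δ * γ⁻¹) * φ γ = φ δ := by rw [← map_mul, inv_mul_cancel_right]
  exact congrArg (fun g : P.Aut ↦ g.indexEquiv i) this

lemma toLinearMap_root_of_mem_rootOrbit {i j : ι} (hj : j ∈ rootOrbit P φ i) {y : Y}
    (hy : y ∈ YBar P φ) : P.toLinearMap (P.root j) y = P.toLinearMap (P.root i) y := by
  obtain ⟨γ, rfl⟩ := hj
  rw [← aut_smul_root, toLinearMap_smul, hy γ]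

variable [Finite ι] {y : Y} (hy : y ∈ YBar P φ) (hreg : ∀ i, P.toLinearMap (P.root i) y ≠ 0)

include hy hreg

/-- Equal lengths leave the pairings `0`, `1`, `-1`. A positive pairing would make the difference a
root, on which `y` vanishes. -/
lemma pairing_of_mem_rootOrbit {i j k : ι} (hj : j ∈ rootOrbit P φ i) (hk : k ∈ rootOrbit P φ i)
    (hjk : j ≠ k) :
    P.IsOrthogonal j k ∨ (P.pairing j k = -1 ∧ P.pairing k j = -1) := by
  have := Fintype.ofFinite ι
  obtain ⟨γ, rfl⟩ := exists_indexEquiv_eq hj hk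
  have hyj := toLinearMap_root_of_mem_rootOrbit hj hy
  have hyk := toLinearMap_root_of_mem_rootOrbit hk hy
  have h1 := RootPairing.pairingIn_pairingIn_mem_set_of_length_eq_of_ne P
    (B := P.toInvariantForm) (i := j) (j := (φ γ).indexEquiv j)
    (by simp only [RootPairing.toInvariantForm_form]; rw [← aut_smul_root, rootForm_smul_smul]) hjk
    (fun h ↦ hreg i (by rw [h, map_neg, LinearMap.neg_apply] at hyj; omega))
  have e (i j : ι) : P.pairingIn ℤ i j = P.pairing i j := by
    simpa using P.algebraMap_pairingIn ℤ i j
  have h2 : ¬ 0 < P.pairingIn ℤ j ((φ γ).indexEquiv j) := by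
    intro h
    obtain ⟨l, hl⟩ := P.root_sub_root_mem_of_pairingIn_pos h hjk
    exact hreg l (by rw [hl, map_sub, LinearMap.sub_apply, hyj, hyk, sub_self])
  simp only [e, Set.mem_insert_iff, Set.mem_singleton_iff, Prod.mk.injEq] at h1 h2
  obtain h1 | h1 | h1 := h1
  · exact .inl h1
  · omega
  · exact .inr h1

/-- The orbit sum `S` is invariant and nonzero, so `(S, S) > 0` forces `⟨S, j^∨⟩ > 0`. The root `j`
contributes `2`, each non-orthogonal partner `-1` and all others `0`, so two partners are too many.
-/
lemma eq_of_not_isOrthogonal {i j k k' : ι} (hj : j ∈ rootOrbit P φ i)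
    (hk : k ∈ rootOrbit P φ i) (hk' : k' ∈ rootOrbit P φ i) (hkj : k ≠ j) (hkj' : k' ≠ j)
    (ho : ¬ P.IsOrthogonal k j) (ho' : ¬ P.IsOrthogonal k' j) : k = k' := by
  classical
  have := Fintype.ofFinite ι
  by_contra hne
  set O := (rootOrbit P φ i).toFinite.toFinset
  have hO (l : ι) : l ∈ O ↔ l ∈ rootOrbit P φ i := Set.Finite.mem_toFinset _
  set S := ∑ l ∈ O, P.root l with hS
  have hSy : P.toLinearMap S y = O.card * P.toLinearMap (P.root i) y := by
    rw [hS, map_sum, LinearMap.sum_apply, Finset.sum_congr rfl fun l hl ↦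
      toLinearMap_root_of_mem_rootOrbit ((hO l).mp hl) hy]
    simp
  have hcard : 0 < O.card := Finset.card_pos.mpr ⟨j, (hO j).mpr hj⟩
  have hS0 : S ≠ 0 := by
    rintro h0
    rw [h0, map_zero, LinearMap.zero_apply] at hSy
    have := hreg i
    simp_all
  have hSpos : 0 < P.RootForm S S := P.rootForm_pos_of_ne_zero
    (Submodule.sum_mem _ fun l _ ↦ Submodule.subset_span ⟨l, rfl⟩) hS0
  have hinv (γ : Γ) : φ γ • S = S := by
    rw [hS, Finset.smul_sum]
    refine Finset.sum_bij' (fun l _ ↦ (φ γ).indexEquiv l) (fun l _ ↦ (φ γ⁻¹).indexEquiv l)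
      (fun l hl ↦ ?_) (fun l hl ↦ ?_) (fun l _ ↦ ?_) (fun l _ ↦ ?_) fun l _ ↦ aut_smul_root P _ l
    · exact (hO _).mpr (indexEquiv_mem_rootOrbit P φ γ ((hO l).mp hl))
    · exact (hO _).mpr (indexEquiv_mem_rootOrbit P φ γ⁻¹ ((hO l).mp hl))
    · rw [map_inv]; exact Equiv.symm_apply_apply _ _
    · rw [map_inv]; exact Equiv.apply_symm_apply _ _
  have hconst (l : ι) (hl : l ∈ O) : P.RootForm S (P.root l) = P.RootForm S (P.root j) := by
    obtain ⟨γ, rfl⟩ := exists_indexEquiv_eq hj ((hO l).mp hl)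
    conv_lhs => rw [← hinv γ, ← aut_smul_root, rootForm_smul_smul]
  have hSj : 0 < P.RootForm S (P.root j) := by
    have : P.RootForm S S = O.card * P.RootForm S (P.root j) := by
      conv_lhs => rw [hS, ← hS, map_sum, Finset.sum_congr rfl hconst]
      simp
    rw [this] at hSpos
    exact (mul_pos_iff_of_pos_left (by exact_mod_cast hcard)).mp hSpos
  have hSj' : 0 < P.toLinearMap S (P.coroot j) := by
    have := two_mul_rootForm_root P S j
    have := rootForm_root_pos P j
    nlinarith
  have hle (l : ι) (hl : l ∈ O \ {j, k, k'}) : P.pairing l j ≤ 0 := by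
    simp only [Finset.mem_sdiff, Finset.mem_insert, Finset.mem_singleton, not_or] at hl
    obtain h | h := pairing_of_mem_rootOrbit hy hreg ((hO l).mp hl.1) hj hl.2.1
    · exact h.1.le
    · omega
  have hsub : {j, k, k'} ⊆ O := by
    intro l
    simp only [Finset.mem_insert, Finset.mem_singleton, hO]
    rintro (rfl | rfl | rfl) <;> assumption
  have h1 := ((pairing_of_mem_rootOrbit hy hreg hk hj hkj).resolve_left ho).1
  have h2 := ((pairing_of_mem_rootOrbit hy hreg hk' hj hkj').resolve_left ho').1
  rw [hS, map_sum, LinearMap.sum_apply, ← Finset.sum_sdiff hsub,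
    Finset.sum_insert (by simp [hkj.symm, hkj'.symm]), Finset.sum_pair hne] at hSj'
  have h3 := Finset.sum_nonpos hle
  simp only [RootPairing.root_coroot_eq_pairing, P.pairing_same, h1, h2] at hSj' h3
  omega

end Orbits

/-! ### The orthogonal sets `Ξ_β` and the induced reflections -/

section Xi

variable {ι X Y Γ : Type*} [AddCommGroup X] [AddCommGroup Y] [Group Γ]
  {P : RootDatum ι X Y} {φ : Γ →* P.Aut}

lemma res_smul (γ : Γ) (x : X) : res P φ (φ γ • x) = res P φ x := by
  apply Subtype.ext
  have h : (1 : ℚ) ⊗ₜ[ℤ] (φ γ • x) = rationalRep P φ γ (1 ⊗ₜ[ℤ] x) := rfl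
  change Representation.Coinvariants.mk _ ((1 : ℚ) ⊗ₜ[ℤ] (φ γ • x)) = _
  rw [h, Representation.Coinvariants.mk_self_apply]
  rfl

lemma res_root_of_mem_rootOrbit {i j : ι} (hj : j ∈ rootOrbit P φ i) :
    res P φ (P.root j) = res P φ (P.root i) := by
  obtain ⟨γ, rfl⟩ := hj
  rw [← aut_smul_root, res_smul]

variable [Finite ι] {y : Y} (hy : y ∈ YBar P φ) (hreg : ∀ i, P.toLinearMap (P.root i) y ≠ 0)

include hy hreg

/-- Since partners are unique, non-orthogonality splits the orbit into mutually orthogonal pairs,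
and distinct sums come from distinct pairs. -/
lemma pairwise_isOrthogonal_Xi (i : ι) : (Xi P φ i).Pairwise P.IsOrthogonal := by
  have := Fintype.ofFinite ι
  by_cases hort : (rootOrbit P φ i).Pairwise P.IsOrthogonal
  · rwa [Xi, if_pos hort]
  · rw [Xi, if_neg hort]
    rintro k ⟨j, hj, j', hj', hne, hno, hk⟩ l ⟨m, hm, m', hm', hne', hno', hl⟩ hkl
    have huniq {a b c : ι} (ha : a ∈ rootOrbit P φ i) (hb : b ∈ rootOrbit P φ i)
        (hc : c ∈ rootOrbit P φ i) (hab : a ≠ b) (hac : a ≠ c)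
        (h : ¬ P.IsOrthogonal a b) (h' : ¬ P.IsOrthogonal a c) : b = c :=
      eq_of_not_isOrthogonal hy hreg ha hb hc hab.symm hac.symm
        (by rwa [P.isOrthogonal_symm]) (by rwa [P.isOrthogonal_symm])
    have hno2 : ¬ P.IsOrthogonal j' j := by rwa [P.isOrthogonal_symm]
    have hno2' : ¬ P.IsOrthogonal m' m := by rwa [P.isOrthogonal_symm]
    have key {a a' b b' : ι} (ha : a ∈ rootOrbit P φ i) (ha' : a' ∈ rootOrbit P φ i)
        (hb : b ∈ rootOrbit P φ i) (hb' : b' ∈ rootOrbit P φ i)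
        (haa : a ≠ a') (hbb : b ≠ b') (hoa : ¬ P.IsOrthogonal a a')
        (hob : ¬ P.IsOrthogonal b b') (hka : P.root k = P.root a + P.root a')
        (hlb : P.root l = P.root b + P.root b') :
        P.RootForm (P.root a) (P.root b) = 0 := by
      rw [← isOrthogonal_iff_rootForm_eq_zero]
      by_contra hab
      by_cases e : a = b
      · subst e
        obtain rfl := huniq ha ha' hb' haa hbb hoa hob
        exact hkl (P.root.injective (hka.trans hlb.symm))
      · obtain rfl := huniq ha ha' hb haa e hoa hab
        obtain rfl := huniq ha' ha hb' haa.symm hbb (by rwa [P.isOrthogonal_symm]) hob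
        exact hkl (P.root.injective (by rw [hka, hlb, add_comm]))
    rw [isOrthogonal_iff_rootForm_eq_zero, hk, hl]
    simp only [map_add, LinearMap.add_apply]
    rw [key hj hj' hm hm' hne hne' hno hno' hk hl,
      key hj' hj hm hm' hne.symm hne' hno2 hno' (by rw [hk, add_comm]) hl,
      key hj hj' hm' hm hne hne'.symm hno hno2' hk (by rw [hl, add_comm]),
      key hj' hj hm' hm hne.symm hne'.symm hno2 hno2' (by rw [hk, add_comm]) (by rw [hl, add_comm])]
    rfl

/-- By transitivity every root of the orbit has a partner, and sending a root to its sum with the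
partner is two-to-one onto `Ξ_β`. -/
lemma ncard_rootOrbit_of_not_pairwise {i : ι}
    (h : ¬ (rootOrbit P φ i).Pairwise P.IsOrthogonal) :
    (rootOrbit P φ i).ncard = 2 * (Xi P φ i).ncard := by
  classical
  have := Fintype.ofFinite ι
  have hmate : ∀ j ∈ rootOrbit P φ i, ∃ j' ∈ rootOrbit P φ i, j ≠ j' ∧ ¬ P.IsOrthogonal j j' := by
    simp only [Set.Pairwise, not_forall] at h
    obtain ⟨a, ha, b, hb, hab, hno⟩ := h
    intro j hj
    obtain ⟨γ, rfl⟩ := exists_indexEquiv_eq ha hj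
    refine ⟨_, indexEquiv_mem_rootOrbit P φ γ hb, fun e ↦ hab ((φ γ).indexEquiv.injective e), ?_⟩
    simpa only [RootPairing.IsOrthogonal, pairing_indexEquiv] using hno
  have hsum : ∀ j ∈ rootOrbit P φ i, ∃ k, ∃ j' ∈ rootOrbit P φ i, j ≠ j' ∧
      ¬ P.IsOrthogonal j j' ∧ P.root k = P.root j + P.root j' := by
    intro j hj
    obtain ⟨j', hj', hne, hno⟩ := hmate j hj
    have h1 := ((pairing_of_mem_rootOrbit hy hreg hj hj' hne).resolve_left hno).1
    have h2 := toLinearMap_root_of_mem_rootOrbit hj hy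
    have h2' := toLinearMap_root_of_mem_rootOrbit hj' hy
    have e : P.pairingIn ℤ j j' = P.pairing j j' := by simpa using P.algebraMap_pairingIn ℤ j j'
    obtain ⟨k, hk⟩ := P.root_add_root_mem_of_pairingIn_neg (i := j) (j := j') (by omega)
      (fun h ↦ hreg i (by rw [h, map_neg, LinearMap.neg_apply] at h2; omega))
    exact ⟨k, j', hj', hne, hno, hk⟩
  choose! f hf using hsum
  have hXi : Xi P φ i = {k | ∃ j ∈ rootOrbit P φ i, ∃ j' ∈ rootOrbit P φ i,
      j ≠ j' ∧ ¬ P.IsOrthogonal j j' ∧ P.root k = P.root j + P.root j'} := if_neg h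
  set O := (rootOrbit P φ i).toFinite.toFinset
  have hO (l : ι) : l ∈ O ↔ l ∈ rootOrbit P φ i := Set.Finite.mem_toFinset _
  set Z := (Xi P φ i).toFinite.toFinset
  have hZ (l : ι) : l ∈ Z ↔ l ∈ Xi P φ i := Set.Finite.mem_toFinset _
  rw [Set.ncard_eq_toFinset_card _ (rootOrbit P φ i).toFinite,
    Set.ncard_eq_toFinset_card _ (Xi P φ i).toFinite]
  change O.card = 2 * Z.card
  have hmaps : Set.MapsTo f (O : Set ι) (Z : Set ι) := fun j hj ↦ by
    obtain ⟨j', hj'⟩ := hf j ((hO j).mp hj)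
    exact (hZ _).mpr (hXi ▸ ⟨j, (hO j).mp hj, j', hj'⟩)
  rw [Finset.card_eq_sum_card_fiberwise hmaps, mul_comm]
  refine Finset.sum_const_nat fun k hk ↦ ?_
  rw [hZ, hXi] at hk
  obtain ⟨a, ha, b, hb, hab, hno, hk⟩ := hk
  refine Finset.card_eq_two.mpr ⟨a, b, hab, ?_⟩
  have hpair {j j' : ι} (hj : j ∈ rootOrbit P φ i) (hj' : j' ∈ rootOrbit P φ i) (hne : j ≠ j') :=
    pairing_of_mem_rootOrbit hy hreg hj hj' hne
  have hfa {a b : ι} (ha : a ∈ rootOrbit P φ i) (hb : b ∈ rootOrbit P φ i) (hab : a ≠ b)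
      (hno : ¬ P.IsOrthogonal a b) (hk : P.root k = P.root a + P.root b) : f a = k := by
    obtain ⟨c, hc, hac, hno', hfc⟩ := hf a ha
    obtain rfl : b = c := eq_of_not_isOrthogonal hy hreg ha hb hc hab.symm hac.symm
      (by rwa [P.isOrthogonal_symm]) (by rwa [P.isOrthogonal_symm])
    exact P.root.injective (hfc.trans hk.symm)
  ext j
  simp only [Finset.mem_filter, hO, Finset.mem_insert, Finset.mem_singleton]
  constructor
  · rintro ⟨hj, rfl⟩
    by_contra! hcon
    obtain ⟨j', hj', hjj', hnoj, hfj⟩ := hf j hj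
    -- Pairing the common sum with `j^∨` gives `2 - 1 = 1` from `j + j'`, but at most `0` from `a +
    -- b`.
    have h1 : P.pairing a j ≤ 0 := by
      obtain h | h := hpair ha hj hcon.1.symm
      exacts [h.1.le, by omega]
    have h2 : P.pairing b j ≤ 0 := by
      obtain h | h := hpair hb hj hcon.2.symm
      exacts [h.1.le, by omega]
    have h3 := ((hpair hj hj' hjj').resolve_left hnoj).2
    have h4 := congrArg (fun x ↦ P.toLinearMap x (P.coroot j)) (hk.symm.trans hfj)
    simp only [map_add, LinearMap.add_apply, RootPairing.root_coroot_eq_pairing,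
      P.pairing_same] at h4
    omega
  · rintro (rfl | rfl)
    · exact ⟨ha, hfa ha hb hab hno hk⟩
    · exact ⟨hb, hfa hb ha hab.symm (by rwa [P.isOrthogonal_symm]) (by rw [hk, add_comm])⟩

/-- The factor in the definition of the coroot of `i^* β` is the ratio of `i^* ξ` and `i^* β` for
`ξ ∈ Ξ_β`. -/
lemma exists_ncard_div_eq (i : ι) :
    ∃ m : ℕ, 0 < m ∧ (Xi P φ i).Nonempty ∧
      (rootOrbit P φ i).ncard / (Xi P φ i).ncard = m ∧
      ∀ k ∈ Xi P φ i, res P φ (P.root k) = (m : ℤ) • res P φ (P.root i) := by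
  have hpos : 0 < (rootOrbit P φ i).ncard := (Set.ncard_pos).mpr ⟨i, self_mem_rootOrbit P φ i⟩
  by_cases hort : (rootOrbit P φ i).Pairwise P.IsOrthogonal
  · have hXi : Xi P φ i = rootOrbit P φ i := if_pos hort
    refine ⟨1, one_pos, ⟨i, hXi ▸ self_mem_rootOrbit P φ i⟩, by rw [hXi, Nat.div_self hpos],
      fun k hk ↦ ?_⟩
    rw [hXi] at hk
    rw [res_root_of_mem_rootOrbit hk, Nat.cast_one, one_smul]
  · have h2 := ncard_rootOrbit_of_not_pairwise hy hreg hort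
    refine ⟨2, two_pos, (Set.ncard_pos).mp (by omega), by rw [h2, Nat.mul_div_cancel _ (by omega)],
      fun k hk ↦ ?_⟩
    rw [Xi, if_neg hort] at hk
    obtain ⟨j, hj, j', hj', -, -, hk⟩ := hk
    rw [hk, map_add, res_root_of_mem_rootOrbit hj, res_root_of_mem_rootOrbit hj', Nat.cast_two,
      two_smul]

/-- For `ξ ∈ Ξ_β`, orthogonality gives `2m` in place of `2`, and `i^*ξ = m • i^*β`. -/
lemma pairingBar_res_root_corootBar (i : ι) :
    pairingBar P φ (res P φ (P.root i)) (corootBar P φ i) = 2 := by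
  obtain ⟨m, hm, ⟨k, hk⟩, hdiv, hres⟩ := exists_ncard_div_eq hy hreg i
  have h1 : pairingBar P φ (res P φ (P.root k)) (corootBar P φ i) = m * 2 := by
    rw [corootBar, hdiv, map_nsmul, pairingBar_res, nsmul_eq_mul]
    change _ * P.toLinearMap _ (∑ l ∈ _, P.coroot l) = _
    rw [map_sum, Finset.sum_eq_single k]
    · simp
    · intro l hl hlk
      rw [Set.Finite.mem_toFinset] at hl
      exact (pairwise_isOrthogonal_Xi hy hreg i hk hl hlk.symm).1
    · simp [hk]
  rw [hres k hk, map_smul, LinearMap.smul_apply, smul_eq_mul] at h1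
  exact mul_left_cancel₀ (by exact_mod_cast hm.ne') h1

/-- The `Γ`-invariant element of the Weyl group that induces the reflection in `i^* β`. -/
lemma exists_mem_fixedWeylGroup (i : ι) :
    ∃ w ∈ fixedWeylGroup P φ, ∀ x : X, res P φ (w • x) =
      res P φ x - pairingBar P φ (res P φ x) (corootBar P φ i) • res P φ (P.root i) := by
  set Z := (Xi P φ i).toFinite.toFinset with hZdef
  have hZ (l : ι) : l ∈ Z ↔ l ∈ Xi P φ i := Set.Finite.mem_toFinset _
  obtain ⟨w, hw, hwx⟩ := exists_mem_weylGroup_of_pairwise_isOrthogonal P Z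
    (by rw [hZdef, Set.Finite.coe_toFinset]; exact pairwise_isOrthogonal_Xi hy hreg i)
  refine ⟨w, ⟨hw, Subgroup.mem_centralizer_iff.mpr ?_⟩, fun x ↦ ?_⟩
  · rintro _ ⟨γ, rfl⟩
    refine aut_ext P fun x ↦ ?_
    rw [mul_smul, mul_smul, hwx, hwx, smul_sub, Finset.smul_sum]
    congr 1
    refine Finset.sum_bij' (fun k _ ↦ (φ γ).indexEquiv k) (fun k _ ↦ (φ γ).indexEquiv.symm k)
      (fun k hk ↦ ?_) (fun k hk ↦ ?_) (fun k _ ↦ ?_) (fun k _ ↦ ?_) fun k _ ↦ ?_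
    · exact (hZ _).mpr (indexEquiv_mem_Xi P φ γ ((hZ k).mp hk))
    · exact (hZ _).mpr (symm_indexEquiv_mem_Xi P φ γ ((hZ k).mp hk))
    · exact Equiv.symm_apply_apply _ _
    · exact Equiv.apply_symm_apply _ _
    · rw [toLinearMap_smul_coroot, ← aut_smul_root, smul_comm]
  · obtain ⟨m, -, -, hm, hres⟩ := exists_ncard_div_eq hy hreg i
    rw [hwx, map_sub, corootBar, hm, map_nsmul, pairingBar_res, map_sum,
      Finset.sum_congr rfl fun k hk ↦ by rw [map_smul, hres k ((hZ k).mp hk)], ← Finset.sum_smul]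
    change _ = _ - (m • P.toLinearMap x (∑ k ∈ Z, P.coroot k)) • _
    rw [map_sum, smul_smul, nsmul_eq_mul, mul_comm]

end Xi

/-! ### Perfect pairing and axioms for the restricted datum -/

section RestrictedDatum

variable {ι X Y Γ : Type*} [AddCommGroup X] [AddCommGroup Y] [Group Γ]
  {P : RootDatum ι X Y} {φ : Γ →* P.Aut}

lemma res_surjective : Function.Surjective (res P φ) := by
  rintro ⟨_, x, rfl⟩
  exact ⟨x, rfl⟩

variable (P φ) in
lemma isTorsionFree_XBar : Module.IsTorsionFree ℤ (XBar P φ) := by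
  have : Module.IsTorsionFree ℤ (rationalRep P φ).Coinvariants :=
    .trans_faithfulSMul ℤ ℚ _
  infer_instance

-- `\bar X^*` lies in a rational vector space and is finitely generated, hence free, so bijectivity
-- on one side suffices. A functional on `\bar X^*` pulls back to an invariant one on `X^*`, which
-- an invariant coweight represents.
variable (P φ) in
lemma isPerfPair_pairingBar [Module.Finite ℤ X] : (pairingBar P φ).IsPerfPair := by
  have := isTorsionFree_XBar P φ
  have : Module.Finite ℤ (XBar P φ) := Module.Finite.range _
  have : Module.Free ℤ (XBar P φ) := Module.free_of_finite_type_torsion_free'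
  refine LinearMap.IsPerfPair.flip (p := (pairingBar P φ).flip)
    (.of_bijective _ ⟨?_, fun f ↦ ?_⟩)
  · rw [injective_iff_map_eq_zero]
    intro y hy
    refine Subtype.ext (P.flip.toPerfPair.injective (LinearMap.ext fun x ↦ ?_))
    have := LinearMap.congr_fun hy (res P φ x)
    rw [LinearMap.flip_apply, pairingBar_res] at this
    simpa using this
  · obtain ⟨y, hy⟩ := exists_toLinearMap_eq P (f ∘ₗ res P φ)
    refine ⟨⟨y, fun γ ↦ P.flip.toPerfPair.injective (LinearMap.ext fun x ↦ ?_)⟩,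
      LinearMap.ext fun x ↦ ?_⟩
    · have : P.toLinearMap x ((φ γ).coweightMap y) = P.toLinearMap x y := by
        rw [← toLinearMap_smul, hy, hy, LinearMap.comp_apply, res_smul, LinearMap.comp_apply]
      simpa using this
    · obtain ⟨x, rfl⟩ := res_surjective x
      rw [LinearMap.flip_apply, pairingBar_res, hy, LinearMap.comp_apply]

variable [Finite ι]

instance : Finite (PhiBar P φ) := Set.finite_range _

lemma corootBar_mem_corootSpan (i : ι) : (corootBar P φ i : Y) ∈ P.corootSpan ℤ := by
  have h : ∑ k ∈ (Xi P φ i).toFinite.toFinset, P.coroot k ∈ P.corootSpan ℤ :=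
    Submodule.sum_mem _ fun k _ ↦ Submodule.subset_span ⟨k, rfl⟩
  exact nsmul_mem h _

/-- An invariant coroot is determined by the reflection property. -/
lemma eq_of_mapsTo_preReflection {i : ι} {c c' : YBar P φ}
    (hc : (c : Y) ∈ P.corootSpan ℤ) (hc' : (c' : Y) ∈ P.corootSpan ℤ)
    (h2 : pairingBar P φ (res P φ (P.root i)) c = 2)
    (h2' : pairingBar P φ (res P φ (P.root i)) c' = 2)
    (hm : Set.MapsTo (Module.preReflection (res P φ (P.root i)) ((pairingBar P φ).flip c))
      (PhiBar P φ) (PhiBar P φ))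
    (hm' : Set.MapsTo (Module.preReflection (res P φ (P.root i)) ((pairingBar P φ).flip c'))
      (PhiBar P φ) (PhiBar P φ)) : c = c' := by
  have := Fintype.ofFinite ι
  have := isTorsionFree_XBar P φ
  -- This gives equality only on the span of `\bar Φ`; membership in the coroot span supplies the
  -- rest.
  have h := Module.Dual.eq_of_preReflection_mapsTo' (R := ℤ) (Set.toFinite (PhiBar P φ))
    (Submodule.subset_span ⟨i, rfl⟩) h2 hm h2' hm'
  have hk (k : ι) : P.toLinearMap (P.root k) (c - c' : Y) = 0 := by
    have := LinearMap.congr_fun h ⟨res P φ (P.root k), Submodule.subset_span ⟨k, rfl⟩⟩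
    simp only [LinearMap.dualMap_apply, Submodule.subtype_apply, LinearMap.flip_apply,
      pairingBar_res] at this
    rw [map_sub, this, sub_self]
  refine Subtype.ext (sub_eq_zero.mp ?_)
  -- `c - c'` kills every root, so its coroot form with itself is zero, while that form is definite
  -- on the coroot span.
  refine P.flip.eq_zero_of_mem_rootSpan_of_rootForm_self_eq_zero (sub_mem hc hc') ?_
  rw [RootPairing.rootForm_apply_apply]
  refine Finset.sum_eq_zero fun k _ ↦ ?_
  have : P.flip.coroot' k (c - c' : Y) = 0 := hk k
  rw [this, zero_mul]

section Regular

variable {y : Y} (hy : y ∈ YBar P φ) (hreg : ∀ i, P.toLinearMap (P.root i) y ≠ 0)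

include hy hreg

lemma mapsTo_preReflection_corootBar (i : ι) :
    Set.MapsTo (Module.preReflection (res P φ (P.root i))
      ((pairingBar P φ).flip (corootBar P φ i))) (PhiBar P φ) (PhiBar P φ) := by
  obtain ⟨w, -, hw⟩ := exists_mem_fixedWeylGroup hy hreg i
  rintro _ ⟨k, rfl⟩
  exact ⟨w.indexEquiv k, by
    dsimp only
    rw [← aut_smul_root, hw, Module.preReflection_apply, LinearMap.flip_apply]⟩

lemma corootBar_eq_of_res_eq {i j : ι} (h : res P φ (P.root i) = res P φ (P.root j)) :
    corootBar P φ i = corootBar P φ j :=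
  eq_of_mapsTo_preReflection (i := i) (corootBar_mem_corootSpan i) (corootBar_mem_corootSpan j)
    (pairingBar_res_root_corootBar hy hreg i) (h ▸ pairingBar_res_root_corootBar hy hreg j)
    (mapsTo_preReflection_corootBar hy hreg i) (h ▸ mapsTo_preReflection_corootBar hy hreg j)

lemma res_root_eq_of_corootBar_eq {i j : ι} (h : corootBar P φ i = corootBar P φ j) :
    res P φ (P.root i) = res P φ (P.root j) := by
  have := isTorsionFree_XBar P φ
  have : IsAddTorsionFree (XBar P φ) := .of_isTorsionFree ℤ _
  have hi := pairingBar_res_root_corootBar hy hreg i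
  have hj := pairingBar_res_root_corootBar hy hreg j
  exact Module.eq_of_mapsTo_reflection_of_mem (f := (pairingBar P φ).flip (corootBar P φ i))
    (g := (pairingBar P φ).flip (corootBar P φ j)) (Set.toFinite (PhiBar P φ)) hi hj
    (by rwa [← h]) (by rwa [h]) (mapsTo_preReflection_corootBar hy hreg i)
    (mapsTo_preReflection_corootBar hy hreg j) ⟨j, rfl⟩

/-- The reflected coroot has the characterizing properties of the coroot of `s_i(i^*β_j)`: its
reflection is `s_i s_j s_i`, which preserves `\bar Φ`. -/
lemma preReflection_corootBar_mem_range (i j : ι) :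
    Module.preReflection (corootBar P φ i) (pairingBar P φ (res P φ (P.root i)))
      (corootBar P φ j) ∈ Set.range (corootBar P φ) := by
  set p := pairingBar P φ
  set c := Module.preReflection (corootBar P φ i) (p (res P φ (P.root i))) (corootBar P φ j)
    with hc
  have hmi := mapsTo_preReflection_corootBar hy hreg i
  have hmj := mapsTo_preReflection_corootBar hy hreg j
  have hi : p (res P φ (P.root i)) (corootBar P φ i) = 2 := pairingBar_res_root_corootBar hy hreg i
  have hj : p (res P φ (P.root j)) (corootBar P φ j) = 2 := pairingBar_res_root_corootBar hy hreg j
  obtain ⟨k, hk⟩ := hmi ⟨j, rfl⟩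
  dsimp only at hk
  refine ⟨k, eq_of_mapsTo_preReflection (i := k) (corootBar_mem_corootSpan k) ?_
    (pairingBar_res_root_corootBar hy hreg k) ?_ (mapsTo_preReflection_corootBar hy hreg k) ?_⟩
  · rw [hc, Module.preReflection_apply, Submodule.coe_sub, Submodule.coe_smul]
    exact sub_mem (corootBar_mem_corootSpan j) (Submodule.smul_mem _ _ (corootBar_mem_corootSpan i))
  · rw [hk, hc, Module.preReflection_apply, Module.preReflection_apply]
    change p _ _ = 2
    simp only [map_sub, map_smul, LinearMap.sub_apply, LinearMap.smul_apply, LinearMap.flip_apply,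
      smul_eq_mul]
    simp only [p] at hi hj ⊢
    rw [hi, hj]
    ring
  · have h3 : Module.preReflection (res P φ (P.root k)) (p.flip c) =
        Module.preReflection (res P φ (P.root i)) (p.flip (corootBar P φ i)) ∘ₗ
        Module.preReflection (res P φ (P.root j)) (p.flip (corootBar P φ j)) ∘ₗ
        Module.preReflection (res P φ (P.root i)) (p.flip (corootBar P φ i)) := by
      have hi' : (p.flip (corootBar P φ i)) (res P φ (P.root i)) = 2 := hi
      rw [← Module.preReflection_preReflection _ _ hi', hk]
      congr 1
      ext x
      simp [hc, Module.preReflection_apply]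
    change Set.MapsTo (Module.preReflection (res P φ (P.root k)) (p.flip c)) _ _
    rw [h3]
    exact hmi.comp (hmj.comp hmi)

end Regular

end RestrictedDatum

/-! ### Comparison of the Weyl groups -/

section Weyl

variable {ι X Y Γ : Type*} [AddCommGroup X] [AddCommGroup Y] [Group Γ]
  {P : RootDatum ι X Y} {φ : Γ →* P.Aut} [Finite ι]

lemma exists_restrictedRootDatum [Module.Finite ℤ X] {y : Y} (hy : y ∈ YBar P φ)
    (hreg : ∀ i, P.toLinearMap (P.root i) y ≠ 0) :
    ∃ Q : RootDatum (PhiBar P φ) (XBar P φ) (YBar P φ),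
      Q.toLinearMap = pairingBar P φ ∧ (∀ α, Q.root α = α) ∧
      ∀ i, Q.coroot (resRoot P φ i) = corootBar P φ i := by
  have := isTorsionFree_XBar P φ
  have := isPerfPair_pairingBar P φ
  have hch (α : PhiBar P φ) : res P φ (P.root α.2.choose) = α := α.2.choose_spec
  let r : PhiBar P φ ↪ XBar P φ := Function.Embedding.subtype _
  let c : PhiBar P φ ↪ YBar P φ := ⟨fun α ↦ corootBar P φ α.2.choose, fun α β h ↦ by
    rw [Subtype.ext_iff, ← hch α, ← hch β]
    exact res_root_eq_of_corootBar_eq hy hreg h⟩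
  have hc (i : ι) : c (resRoot P φ i) = corootBar P φ i :=
    corootBar_eq_of_res_eq hy hreg (hch (resRoot P φ i))
  have hr : Set.range r = PhiBar P φ := Subtype.range_coe
  have hcr : Set.range (corootBar P φ) ⊆ Set.range c := by
    rintro _ ⟨i, rfl⟩
    exact ⟨_, hc i⟩
  refine ⟨RootPairing.mk' (pairingBar P φ) r c ?_ ?_ ?_, rfl, fun _ ↦ rfl, hc⟩
  · rintro ⟨_, i, rfl⟩
    exact (congrArg _ (hc i)).trans (pairingBar_res_root_corootBar hy hreg i)
  · rintro ⟨_, i, rfl⟩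
    have h := hc i
    unfold resRoot at h
    rw [hr, h]
    exact mapsTo_preReflection_corootBar hy hreg i
  · rintro ⟨_, i, rfl⟩ _ ⟨⟨_, j, rfl⟩, rfl⟩
    have h := hc i
    have h' := hc j
    unfold resRoot at h h'
    rw [h, h']
    exact hcr (preReflection_corootBar_mem_range hy hreg i j)

omit [Finite ι] in
lemma coweightMap_mem_YBar {w : P.Aut} (hw : w ∈ fixedWeylGroup P φ) {y : Y}
    (hy : y ∈ YBar P φ) : w.coweightMap y ∈ YBar P φ := by
  intro γ
  have h := Subgroup.mem_centralizer_iff.mp hw.2 (φ γ) ⟨γ, rfl⟩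
  have h1 : (φ γ).coweightMap (w.coweightMap y) = (w * φ γ).coweightMap y := rfl
  have h2 : w.coweightMap ((φ γ).coweightMap y) = (φ γ * w).coweightMap y := rfl
  rw [h1, ← h, ← h2, hy γ]

variable {Δ : Set ι} (hΔ : IsSimpleRootSet P Δ) {y : Y} (hy : y ∈ YBar P φ)
  (hdom : IsDominant P Δ y)

include hΔ hy hdom

/-- `W^Γ` acts faithfully on `\bar X^*`. -/
lemma fixedWeylGroup_ext [Module.Finite ℤ X] {w w' : fixedWeylGroup P φ}
    (h : ∀ x : X, res P φ (w • x) = res P φ (w' • x)) : w = w' := by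
  have h1 : (w'⁻¹ * w : fixedWeylGroup P φ).1 = 1 := by
    refine hΔ.eq_one_of_pos hdom (w'⁻¹ * w).2.1 fun i hi ↦ ?_
    -- Pairing with an invariant coweight sees only the image under `i^*`, so `w'⁻¹ * w` preserves
    -- values on `y`.
    have hmem := coweightMap_mem_YBar (w'⁻¹).2 hy
    have e : P.toLinearMap ((w'⁻¹ * w : fixedWeylGroup P φ).1 • P.root i) y =
        P.toLinearMap (P.root i) y := by
      have h2 : (w'⁻¹ * w : fixedWeylGroup P φ).1 • P.root i = (w'⁻¹).1 • (w • P.root i) :=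
        mul_smul _ _ _
      rw [h2, toLinearMap_smul, ← pairingBar_res P φ _ ⟨_, hmem⟩, h, pairingBar_res,
        ← toLinearMap_smul]
      congr 2
      exact inv_smul_smul w' (P.root i)
    rwa [e]
  have h2 : w'⁻¹ * w = 1 := Subtype.ext h1
  rwa [inv_mul_eq_one, eq_comm] at h2

variable {Q : RootDatum (PhiBar P φ) (XBar P φ) (YBar P φ)}
  (hQ : Q.toLinearMap = pairingBar P φ) (hroot : ∀ α, Q.root α = α)
  (hcoroot : ∀ i, Q.coroot (resRoot P φ i) = corootBar P φ i)

include hQ hroot hcoroot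

lemma exists_fixedWeylGroup_of_weylGroup (v : Q.weylGroup) :
    ∃ w : fixedWeylGroup P φ, ∀ x : X, v • res P φ x = res P φ (w • x) := by
  obtain ⟨v, hv⟩ := v
  change ∃ w : fixedWeylGroup P φ, ∀ x : X, v • res P φ x = res P φ (w • x)
  induction hv using RootPairing.weylGroup.induction with
  | mem α =>
    obtain ⟨_, i, rfl⟩ := α
    obtain ⟨w, hw, h⟩ := exists_mem_fixedWeylGroup hy (hΔ.toLinearMap_ne_zero hdom) i
    refine ⟨⟨w, hw⟩, fun x ↦ ?_⟩
    change _ = res P φ (w • x)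
    have hci := hcoroot i
    unfold resRoot at hci
    rw [h, reflection_smul_eq, hroot, hci, hQ]
  | one => exact ⟨1, fun x ↦ by rw [one_smul, one_smul]⟩
  | mul v v' _ _ h h' =>
    obtain ⟨w, hw⟩ := h
    obtain ⟨w', hw'⟩ := h'
    exact ⟨w * w', fun x ↦ by rw [mul_smul, mul_smul, hw', hw]⟩

lemma exists_weylGroup_of_fixedWeylGroup [Module.Finite ℤ X] (w : fixedWeylGroup P φ) :
    ∃ v : Q.weylGroup, ∀ x : X, v • res P φ x = res P φ (w • x) := by
  have := Fintype.ofFinite (PhiBar P φ)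
  let y₀ : YBar P φ := ⟨y, hy⟩
  let z : YBar P φ := ⟨w.1.coweightMap y, coweightMap_mem_YBar w.2 hy⟩
  -- The form of `v.coweightMap z` with `y₀` depends on `v` only through its permutation of the
  -- finite set `\bar Φ`, so it attains a maximum over `\bar W`.
  let G (e : PhiBar P φ ≃ PhiBar P φ) : ℤ :=
    ∑ α, Q.toLinearMap (Q.root (e α)) z * Q.toLinearMap (Q.root α) y₀
  have hG (v : Q.Aut) : G v.indexEquiv = Q.CorootForm (v.coweightMap z) y₀ := by
    rw [Q.corootForm_apply_apply]
    refine Finset.sum_congr rfl fun α _ ↦ ?_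
    rw [← aut_smul_root, toLinearMap_smul]
  obtain ⟨_, ⟨v, rfl⟩, hmax⟩ := Set.exists_max_image
    (Set.range fun v : Q.weylGroup ↦ v.1.indexEquiv) G (Set.toFinite _) ⟨_, 1, rfl⟩
  replace hmax (α : PhiBar P φ) : Q.CorootForm
      ((v.1 * RootPairing.Equiv.reflection Q α).coweightMap z) y₀ ≤
      Q.CorootForm (v.1.coweightMap z) y₀ := by
    rw [← hG, ← hG]
    exact hmax _ ⟨v * ⟨_, Q.reflection_mem_weylGroup α⟩, rfl⟩
  obtain ⟨u, hu⟩ := exists_fixedWeylGroup_of_weylGroup hΔ hy hdom hQ hroot hcoroot v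
  have huw : w * u = 1 := by
    refine Subtype.ext (hΔ.eq_one_of_pos hdom (w * u).2.1 fun i hi ↦ ?_)
    set α := resRoot P φ i
    have hα : Q.root α = res P φ (P.root i) := hroot α
    have hval : P.toLinearMap ((w * u).1 • P.root i) y =
        Q.toLinearMap (Q.root α) (v.1.coweightMap z) := by
      have h1 : (w * u).1 • P.root i = w.1 • (u • P.root i) := mul_smul _ _ _
      rw [h1, toLinearMap_smul, ← toLinearMap_smul Q, hα]
      change _ = Q.toLinearMap (v • res P φ (P.root i)) z
      rw [hu, hQ, pairingBar_res]
    have hne : P.toLinearMap ((w * u).1 • P.root i) y ≠ 0 := by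
      rw [aut_smul_root]
      exact hΔ.toLinearMap_ne_zero hdom _
    rw [hval] at hne ⊢
    refine lt_of_le_of_ne ?_ hne.symm
    -- If `α` were negative on `v.coweightMap z`, replacing `v` by `v * s_α` would increase the form
    -- with `y₀`, since `α^∨` has positive form with `y₀`.
    have h2 : (v.1 * RootPairing.Equiv.reflection Q α).coweightMap z =
        v.1.coweightMap z - Q.toLinearMap (Q.root α) (v.1.coweightMap z) • Q.coroot α :=
      Q.coreflection_apply α (v.1.coweightMap z)
    have h3 := hmax α
    rw [h2, map_sub, map_smul, LinearMap.sub_apply, LinearMap.smul_apply, smul_eq_mul] at h3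
    have h4 := two_mul_rootForm_root Q.flip y₀ α
    have h5 := rootForm_root_pos Q.flip α
    have h6 : Q.flip.toLinearMap y₀ (Q.flip.coroot α) = P.toLinearMap (P.root i) y := by
      change Q.toLinearMap (Q.root α) y₀ = _
      rw [hα, hQ, pairingBar_res]
    rw [h6] at h4
    have h7 : Q.CorootForm (Q.coroot α) y₀ = Q.flip.RootForm y₀ (Q.flip.root α) := by
      rw [← Q.flip.rootForm_symmetric.eq]; rfl
    have h8 : 0 < Q.CorootForm (Q.coroot α) y₀ := by
      rw [h7]
      have := mul_pos hi h5
      omega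
    by_contra! hneg
    have := mul_neg_of_neg_of_pos hneg h8
    omega
  refine ⟨v⁻¹, fun x ↦ ?_⟩
  rw [inv_smul_eq_iff, hu, ← mul_smul, mul_eq_one_comm.mp huw, one_smul]

end Weyl

end RestrictedRootDatum
end

open RestrictedRootDatum in
theorem mainTheorem5 {ι X Y Γ : Type*} [Finite ι]
    [AddCommGroup X] [AddCommGroup Y] [Module.Finite ℤ X] [Module.Finite ℤ Y]
    (P : RootDatum ι X Y) [Group Γ] [Finite Γ] (φ : Γ →* P.Aut)
    (Δ : Set ι) (hΔ : IsSimpleRootSet P Δ) (hΓ : ∀ γ, ∀ i ∈ Δ, (φ γ).indexEquiv i ∈ Δ) :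
    -- the restricted root datum `\bar Ψ = (\bar X^*, \bar Φ, \bar X_*, \bar Φ^∨)`
    ∃ Q : RootDatum (PhiBar P φ) (XBar P φ) (YBar P φ),
      Q.toLinearMap = pairingBar P φ ∧
      (∀ α, Q.root α = α) ∧
      (∀ i, Q.coroot (resRoot P φ i) = corootBar P φ i) ∧
      -- the embedding `f` of its Weyl group into `W^Γ`
      ∃ f : Q.weylGroup →* fixedWeylGroup P φ,
        (∀ (v : Q.weylGroup) (w : fixedWeylGroup P φ),
          f v = w ↔ ∀ x : X, v • res P φ x = res P φ (w • x)) ∧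
        Function.Bijective f := by
  obtain ⟨y, hy, hdom⟩ := hΔ.exists_isDominant P φ hΓ
  obtain ⟨Q, hQ, hroot, hcoroot⟩ := exists_restrictedRootDatum hy (hΔ.toLinearMap_ne_zero hdom)
  choose g hg using exists_fixedWeylGroup_of_weylGroup hΔ hy hdom hQ hroot hcoroot
  have huniq {w w' : fixedWeylGroup P φ} (h : ∀ x : X, res P φ (w • x) = res P φ (w' • x)) :
      w = w' := fixedWeylGroup_ext hΔ hy hdom h
  have hiff (v : Q.weylGroup) (w : fixedWeylGroup P φ) :
      g v = w ↔ ∀ x : X, v • res P φ x = res P φ (w • x) :=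
    ⟨fun h ↦ h ▸ hg v, fun h ↦ huniq fun x ↦ by rw [← hg, h]⟩
  have hinj : Function.Injective g := fun v v' h ↦ by
    refine Subtype.ext (aut_ext Q fun x ↦ ?_)
    obtain ⟨x, rfl⟩ := res_surjective x
    have h1 := hg v x
    rw [h, ← hg v' x] at h1
    exact h1
  have hsurj : Function.Surjective g := fun w ↦
    (exists_weylGroup_of_fixedWeylGroup hΔ hy hdom hQ hroot hcoroot w).imp fun v hv ↦
      (hiff v w).mpr hv
  exact ⟨Q, hQ, hroot, hcoroot, MonoidHom.mk' g fun v v' ↦ (hiff _ _).mpr fun x ↦ by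
    rw [mul_smul, mul_smul, hg, hg], hiff, hinj, hsurj⟩
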